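/- Let $\mathcal X\subset\mathbb R^{d_{\mathcal X}}$ and $\mathcal Z\subset\mathbb R^{d_{\mathcal Z}}$ be finite, and let $\mathcal F=\{F,f\}\cup\mathcal C_{\mathrm{up}}\cup\mathcal C_{\mathrm{lo}}$ be a finite family of random functions $\mathcal X\times\mathcal Z\to\mathbb R$ (upper- and lower-level objectives, upper- and lower-level constraints). Each $h\in\mathcal F$ is drawn from a Gaussian process with mean function $m_h$ and covariance function $k_h$, and the functions in $\mathcal F$ are independent. For each $h$ a finite set $\mathcal D_{h,0}$ of initial noisy observations of $h$ is given. In each round $t\ge 1$ a query point $(\mathbf x_t,\mathbf z_t)\in\mathcal X\times\mathcal Z$ and a set $Q_t\subseteq\mathcal F$ of functions (a single function in the decoupled setting, all of $\mathcal F$ in the coupled one) are chosen by an arbitrary rule that depends only on the observations made before round $t$ and on internal randomness; the initial design points depend only on this internal randomness. Then $y_h(\mathbf x_t,\mathbf z_t)=h(\mathbf x_t,\mathbf z_t)+\epsilon_{h,t}$ is observed for $h\in Q_t$ and added to the data set of $h$, giving $\mathcal D_{h,t}$. All noises, including those of the initial observations, are distributed as $\mathcal N(0,\sigma_n^2)$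 with $\sigma_n>0$, and the functions, the noises and the internal randomness are mutually independent. Let $\mathcal D_{h,t-1}$ consist of input points $p_1,\dots,p_N$ (with repetitions) and observations $y=(y_1,\dots,y_N)$. With $K=[k_h(p_i,p_j)]_{i,j}$, $\mathbf k(p)=[k_h(p_i,p)]_i$ and $\mathbf m=[m_h(p_i)]_i$, the posterior mean and variance of $h$ at $p\in\mathcal X\times\mathcal Z$ are $$\mu_{h,t-1}(p)=m_h(p)+\mathbf k(p)^\top(K+\sigma_n^2I)^{-1}(y-\mathbf m),\qquad \sigma^2_{h,t-1}(p)=k_h(p,p)-\mathbf k(p)^\top(K+\sigma_n^2I)^{-1}\mathbf k(p).$$ Let $\delta\in(0,1)$, $\beta_t=2\log\big(|\mathcal F||\mathcal X||\mathcal Z|\,t^2\pi^2/(6\delta)\big)$, $u_{h,t}=\mu_{h,t-1}+\beta_t^{1/2}\sigma_{h,t-1}$, and let $$\mathcal S_t^+=\{(\mathbf x,\mathbf z)\in\mathcal X\times\mathcal Z : u_{c,t}(\mathbf x,\mathbf z)\ge 0\ \ \forall c\in\mathcal C_{\mathrm{up}}\cup\mathcal C_{\mathrm{lo}}\}$$ be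 the trusted feasible set. Then, with probability at least $1-\delta$, for all $t\ge 1$, all $(\mathbf x,\mathbf z)\in\mathcal S_t^+$ and all $c\in\mathcal C_{\mathrm{up}}\cup\mathcal C_{\mathrm{lo}}$, the constraint regret satisfies $$r_c(\mathbf x,\mathbf z)=\max(0,-c(\mathbf x,\mathbf z))\le 2\beta_t^{1/2}\sigma_{c,t-1}(\mathbf x,\mathbf z).$$ -/

import Mathlib

open MeasureTheory ProbabilityTheory
open scoped NNReal ENNReal Matrix

/-! ### Gaussian process posteriors -/

section GP

variable {D : Type*}

/-- The Gram matrix `[k(d, d')]` over the (possibly repeated) input points of a data set. -/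
def gramMatrix (k : D → D → ℝ) (L : List (D × ℝ)) : Matrix (Fin L.length) (Fin L.length) ℝ :=
  Matrix.of fun i j => k (L.get i).1 (L.get j).1

/-- The vector `[k(p, d)]` over the input points `d` of a data set. -/
def crossVec (k : D → D → ℝ) (L : List (D × ℝ)) (p : D) : Fin L.length → ℝ :=
  fun i => k p (L.get i).1

/-- The centred observations `y - m` of a data set. -/
def residualVec (m : D → ℝ) (L : List (D × ℝ)) : Fin L.length → ℝ :=
  fun i => (L.get i).2 - m (L.get i).1

/-- GP posterior mean `m(p) + k(p)ᵀ (K + s² I)⁻¹ (y - m)` given the data set `L`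
of pairs (input, noisy observation), with noise standard deviation `s`. -/
noncomputable def postMean (m : D → ℝ) (k : D → D → ℝ) (s : ℝ) (L : List (D × ℝ)) (p : D) : ℝ :=
  m p + crossVec k L p ⬝ᵥ ((gramMatrix k L + s ^ 2 • 1)⁻¹ *ᵥ residualVec m L)

/-- GP posterior variance `k(p, p) - k(p)ᵀ (K + s² I)⁻¹ k(p)` given the data set `L`. -/
noncomputable def postVar (k : D → D → ℝ) (s : ℝ) (L : List (D × ℝ)) (p : D) : ℝ :=
  k p p - crossVec k L p ⬝ᵥ ((gramMatrix k L + s ^ 2 • 1)⁻¹ *ᵥ crossVec k L p)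

/-- GP posterior standard deviation. -/
noncomputable def postSD (k : D → D → ℝ) (s : ℝ) (L : List (D × ℝ)) (p : D) : ℝ :=
  √(postVar k s L p)

/-- `g` is a Gaussian process with mean function `m` and covariance function `k`. -/
def IsGP {Ω : Type*} [MeasurableSpace Ω] (P : Measure Ω) (g : D → Ω → ℝ)
    (m : D → ℝ) (k : D → D → ℝ) : Prop :=
  IsGaussianProcess g P ∧ (∀ p, ∫ ω, g p ω ∂P = m p) ∧ ∀ p q, cov[g p, g q; P] = k p q

end GP

/-! ### Sequential noisy querying of several black-box functions -/

/-- The random quantities appearing when the functions indexed by `ι`, defined on the domain `D`,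
are queried sequentially. Rounds are numbered `1, 2, …`; the entries at round `0` of `x`, `Q`, `ε`
are never used. -/
structure QueryRun (Ω ι D : Type*) where
  /-- the random functions -/
  g : ι → D → Ω → ℝ
  /-- number of initial observations of each function -/
  n₀ : ι → ℕ
  /-- input points of the initial observations -/
  x₀ : (h : ι) → Fin (n₀ h) → Ω → D
  /-- noise of the initial observations -/
  ε₀ : (h : ι) → Fin (n₀ h) → Ω → ℝ
  /-- query point of each round -/
  x : ℕ → Ω → D
  /-- set of functions observed in each round: a singleton in the decoupled setting,
  everything in the coupled one, empty once the algorithm has stopped -/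
  Q : ℕ → Ω → Finset ι
  /-- observation noise of each round and function -/
  ε : ℕ → ι → Ω → ℝ
  /-- information carried by the internal randomness (initial design, tie-breaking, sampling) of
  the query rule -/
  seed : MeasurableSpace Ω

/-- Labels of the elementary sources of randomness of a run. -/
inductive Source (ι : Type*) (n₀ : ι → ℕ) where
  | seed : Source ι n₀
  | function (h : ι) : Source ι n₀
  | initialNoise (h : ι) (i : Fin (n₀ h)) : Source ι n₀
  | noise (t : ℕ) (h : ι) : Source ι n₀

namespace QueryRun

variable {Ω ι D : Type*}

/-- The `i`-th initial observation of `h`. -/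
def initialObs (R : QueryRun Ω ι D) (h : ι) (i : Fin (R.n₀ h)) (ω : Ω) : ℝ :=
  R.g h (R.x₀ h i ω) ω + R.ε₀ h i ω

/-- The noisy value `y_h(x_t) = h(x_t) + ε` of `h` at the query point of round `t`. -/
def obs (R : QueryRun Ω ι D) (t : ℕ) (h : ι) (ω : Ω) : ℝ :=
  R.g h (R.x t ω) ω + R.ε t h ω

/-- The data set of `h` after `t` rounds: the initial observations, followed by the observations
in those rounds in which `h` was observed. -/
def data [DecidableEq ι] (R : QueryRun Ω ι D) (h : ι) : ℕ → Ω → List (D × ℝ)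
  | 0, ω => List.ofFn fun i => (R.x₀ h i ω, R.initialObs h i ω)
  | t + 1, ω => R.data h t ω ++
      if h ∈ R.Q (t + 1) ω then [(R.x (t + 1) ω, R.obs (t + 1) h ω)] else []

/-- The σ-algebra of everything known to the query rule after `t` rounds: its internal randomness,
the initial observations, and the observations made in rounds `1, …, t` (the value of a function
that is not observed is replaced by `0`). -/
def history [DecidableEq ι] (R : QueryRun Ω ι D) : ℕ → MeasurableSpace Ω
  | 0 => R.seed ⊔ ⨆ h, ⨆ i, MeasurableSpace.comap (R.initialObs h i) inferInstance
  | t + 1 => R.history t ⊔ ⨆ h, MeasurableSpace.comap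
      (fun ω => if h ∈ R.Q (t + 1) ω then R.obs (t + 1) h ω else 0) inferInstance

/-- The query rule is non-anticipating: the initial points depend only on the internal randomness,
and the query point and the set of observed functions of each round depend only on what is known
after the previous rounds. -/
def NonAnticipating [DecidableEq ι] [MeasurableSpace D] (R : QueryRun Ω ι D) : Prop :=
  (∀ h i, Measurable[R.seed] (R.x₀ h i)) ∧
  (∀ t, Measurable[R.history t] (R.x (t + 1))) ∧
  (∀ t h, MeasurableSet[R.history t] {ω | h ∈ R.Q (t + 1) ω})

/-- The σ-algebra generated by each elementary source of randomness. -/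
def sourceAlgebra (R : QueryRun Ω ι D) : Source ι R.n₀ → MeasurableSpace Ω
  | .seed => R.seed
  | .function h => MeasurableSpace.comap (fun ω p => R.g h p ω) MeasurableSpace.pi
  | .initialNoise h i => MeasurableSpace.comap (R.ε₀ h i) inferInstance
  | .noise t h => MeasurableSpace.comap (R.ε t h) inferInstance

/-- The probabilistic model: every function `h` is drawn from its Gaussian process prior with mean
`m h` and covariance `k h`, all noises are `N(0, σn²)`, and the functions, the noises and the
internal randomness of the query rule are mutually independent. -/
structure IsModel [MeasurableSpace Ω] (R : QueryRun Ω ι D) (P : Measure Ω)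
    (m : ι → D → ℝ) (k : ι → D → D → ℝ) (σn : ℝ≥0) : Prop where
  measurable_g : ∀ h p, Measurable (R.g h p)
  measurable_ε₀ : ∀ h i, Measurable (R.ε₀ h i)
  measurable_ε : ∀ t h, Measurable (R.ε t h)
  seed_le : R.seed ≤ ‹MeasurableSpace Ω›
  prior : ∀ h, IsGP P (R.g h) (m h) (k h)
  law_ε₀ : ∀ h i, P.map (R.ε₀ h i) = gaussianReal 0 (σn ^ 2)
  law_ε : ∀ t h, P.map (R.ε t h) = gaussianReal 0 (σn ^ 2)
  indep : iIndep R.sourceAlgebra P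

/-- Posterior mean `μ_{h,t}(p)` after `t` rounds. -/
noncomputable def mu [DecidableEq ι] (R : QueryRun Ω ι D) (m : ι → D → ℝ) (k : ι → D → D → ℝ)
    (σn : ℝ≥0) (h : ι) (t : ℕ) (p : D) (ω : Ω) : ℝ :=
  postMean (m h) (k h) σn (R.data h t ω) p

/-- Posterior standard deviation `σ_{h,t}(p)` after `t` rounds. -/
noncomputable def sd [DecidableEq ι] (R : QueryRun Ω ι D) (k : ι → D → D → ℝ)
    (σn : ℝ≥0) (h : ι) (t : ℕ) (p : D) (ω : Ω) : ℝ :=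
  postSD (k h) σn (R.data h t ω) p

/-- Upper confidence bound `u_{h,t}(p) = μ_{h,t-1}(p) + β_t^{1/2} σ_{h,t-1}(p)`, for `t ≥ 1`. -/
noncomputable def ucb [DecidableEq ι] (R : QueryRun Ω ι D) (m : ι → D → ℝ) (k : ι → D → D → ℝ)
    (σn : ℝ≥0) (β : ℕ → ℝ) (h : ι) (t : ℕ) (p : D) (ω : Ω) : ℝ :=
  R.mu m k σn h (t - 1) p ω + √(β t) * R.sd k σn h (t - 1) p ω

/-- The trusted feasible set `S⁺_t`: the points at which the upper confidence bounds of all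
constraints `c ∈ C` are nonnegative. -/
def trustedFeasible [DecidableEq ι] (R : QueryRun Ω ι D) (m : ι → D → ℝ) (k : ι → D → D → ℝ)
    (σn : ℝ≥0) (β : ℕ → ℝ) (C : Finset ι) (t : ℕ) (ω : Ω) : Set D :=
  {p | ∀ c ∈ C, 0 ≤ R.ucb m k σn β c t p ω}

/-- The constraint regret (constraint violation) `r_c(p) = max(0, -c(p))`. -/
noncomputable def constraintRegret (R : QueryRun Ω ι D) (c : ι) (p : D) (ω : Ω) : ℝ :=
  max 0 (-R.g c p ω)

end QueryRun

/-- `β_t = 2 log(|𝓕| |𝒳| |𝒵| t² π² / (6 δ))`. -/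
noncomputable def betaCoeff (nF nX nZ : ℕ) (δ : ℝ) (t : ℕ) : ℝ :=
  2 * Real.log (nF * nX * nZ * t ^ 2 * Real.pi ^ 2 / (6 * δ))

/-! The regret bound is deterministic wherever the lower confidence bound `μ - √β σ ≤ c` holds: a
nonnegative upper bound gives `μ ≥ -√β σ`, hence `c ≥ -2 √β σ`. It remains to bound the probability
that some lower bound fails. A single failure has probability at most `exp (-β_t / 2)`, which is `6δ
/ (π² t²)` divided by `|𝓕||𝒳||𝒵|`; summing over functions, points and rounds gives `δ`, because `∑ 1
/ t² = π² / 6`.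

The difficulty in a single failure is that the design is adaptive. No conditional laws are used. The
design of finitely many rounds takes finitely many values, so it suffices to bound the failure on
the event that the design is a prescribed one. There the data are those of the run with the design
frozen. In the frozen run, `h(p)` minus its posterior mean is uncorrelated with the observations of
`h` and jointly Gaussian with them, hence independent of them, and its variance is the posterior
variance (`IsGP.residual`). It is also independent of all other sources of randomness. Since the
design event is measurable in the frozen history (`measurableSet_designEvent`), the failure and the
design event are independent up to an inclusion, and the Gaussian tail factors out. Summing over
designs removes the restriction. -/

/-! ### Auxiliary facts on independence and Gaussian tails -/

/-- If `a` is independent of `b` and `a ⊔ b` is independent of `c`, then `a` is independent of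
`b ⊔ c`. -/
theorem ProbabilityTheory.Indep.sup_right_of_sup_left {Ω : Type*} {a b c : MeasurableSpace Ω}
    {mΩ : MeasurableSpace Ω} {P : Measure Ω} [IsProbabilityMeasure P]
    (ha : a ≤ mΩ) (hb : b ≤ mΩ) (hc : c ≤ mΩ) (hab : Indep a b P) (habc : Indep (a ⊔ b) c P) :
    Indep a (b ⊔ c) P := by
  have hbc : Indep b c P := indep_of_indep_of_le_left habc le_sup_right
  -- The intersections `B ∩ C` form a π-system generating `b ⊔ c`, so the product formula need only
  -- be checked on them.
  refine IndepSets.indep (p1 := {s | MeasurableSet[a] s})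
    (p2 := {s | ∃ B C, MeasurableSet[b] B ∧ MeasurableSet[c] C ∧ s = B ∩ C}) ha (sup_le hb hc)
    (@MeasurableSpace.isPiSystem_measurableSet Ω a) ?_
    (@MeasurableSpace.generateFrom_measurableSet Ω a).symm ?_ ?_
  · rintro _ ⟨B, C, hB, hC, rfl⟩ _ ⟨B', C', hB', hC', rfl⟩ -
    exact ⟨B ∩ B', C ∩ C', hB.inter hB', hC.inter hC', Set.inter_inter_inter_comm ..⟩
  · refine le_antisymm (sup_le ?_ ?_) (MeasurableSpace.generateFrom_le ?_)
    · intro B hB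
      exact MeasurableSpace.measurableSet_generateFrom
        ⟨B, Set.univ, hB, MeasurableSet.univ, by simp⟩
    · intro C hC
      exact MeasurableSpace.measurableSet_generateFrom
        ⟨Set.univ, C, MeasurableSet.univ, hC, by simp⟩
    · rintro _ ⟨B, C, hB, hC, rfl⟩
      exact MeasurableSet.inter (le_sup_left (a := b) (b := c) B hB)
        (le_sup_right (a := b) (b := c) C hC)
  · rw [IndepSets_iff]
    rintro A _ hA ⟨B, C, hB, hC, rfl⟩
    have hAB : MeasurableSet[a ⊔ b] (A ∩ B) := MeasurableSet.inter
      (le_sup_left (a := a) (b := b) A hA) (le_sup_right (a := a) (b := b) B hB)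
    rw [← Set.inter_assoc, (Indep_iff _ _ P).1 habc _ _ hAB hC,
      (Indep_iff _ _ P).1 hab _ _ hA hB, (Indep_iff _ _ P).1 hbc _ _ hB hC, mul_assoc]

/-- Lower tail bound for a centred real Gaussian variable; the variance may vanish. -/
theorem ProbabilityTheory.HasGaussianLaw.measure_lt_neg_mul_sqrt_variance_le {Ω : Type*}
    {mΩ : MeasurableSpace Ω} {P : Measure Ω} {Y : Ω → ℝ}
    (hY : HasGaussianLaw Y P) (hmean : P[Y] = 0) {b : ℝ} (hb : 0 ≤ b) :
    P.real {ω | Y ω < -(b * √Var[Y; P])} ≤ Real.exp (-b ^ 2 / 2) := by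
  have := hY.isProbabilityMeasure
  have hmap : P.map Y = gaussianReal 0 Var[Y; P].toNNReal := by
    rw [hY.map_eq_gaussianReal, hmean]
  have hv : 0 ≤ Var[Y; P] := variance_nonneg Y P
  have hsub : HasSubgaussianMGF (-Y) Var[Y; P].toNNReal P := by
    have hneg : P.map (-Y) = gaussianReal 0 Var[Y; P].toNNReal := by
      rw [(hY.neg).map_eq_gaussianReal, variance_neg]
      simp [integral_neg, hmean]
    refine ⟨fun t => ?_, fun t => ?_⟩
    · have := integrable_exp_mul_gaussianReal (μ := 0) (v := Var[Y; P].toNNReal) t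
      rw [← hneg] at this
      exact (integrable_map_measure (by fun_prop) hY.neg.aemeasurable).1 this
    · rw [mgf_gaussianReal hneg]; simp
  -- With zero variance `Y = 0` almost surely, and the event, defined by a strict inequality,
  -- becomes the null event `Y < 0`.
  rcases hv.eq_or_lt with h0 | h0
  · rw [← h0, Real.toNNReal_zero] at hsub
    have hz := hsub.ae_eq_zero_of_hasSubgaussianMGF_zero
    have : P {ω | Y ω < -(b * √Var[Y; P])} = 0 := by
      rw [← h0]
      refine measure_mono_null (fun ω hω => ?_) hz
      simp only [Real.sqrt_zero, mul_zero, neg_zero, Set.mem_ofPred_eq] at hω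
      simpa using hω.ne
    simp [Measure.real, this, Real.exp_nonneg]
  · have h := hsub.measure_ge_le (ε := b * √Var[Y; P]) (by positivity)
    refine (measureReal_mono fun ω hω => ?_).trans (h.trans_eq ?_)
    · simp only [Set.mem_ofPred_eq, Pi.neg_apply] at hω ⊢
      linarith
    · congr 1
      rw [Real.coe_toNNReal _ hv, mul_pow, Real.sq_sqrt hv]
      field_simp

/-! ### The residual of a Gaussian process given noisy observations at fixed points -/

section Residual

variable {Ω D : Type*} {mΩ : MeasurableSpace Ω} {P : Measure Ω}
  {g : D → Ω → ℝ} {m : D → ℝ} {k : D → D → ℝ}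

/-- The matrix `K + s² I` of the covariances of noisy observations at the points `q`. -/
def noisyGram {n : ℕ} (k : D → D → ℝ) (s : ℝ) (q : Fin n → D) : Matrix (Fin n) (Fin n) ℝ :=
  Matrix.of (fun i j => k (q i) (q j)) + s ^ 2 • 1

/-- The length of a data set is random. Once it is known, the posterior can be rewritten over a
fixed index type `Fin n`, where covariances are computed. -/
theorem postMean_eq_of_get (s : ℝ) {n : ℕ} (q : Fin n → D) (y : Fin n → ℝ) {L : List (D × ℝ)}
    (hL : L.length = n) (h : ∀ i : Fin n, L.get (Fin.cast hL.symm i) = (q i, y i)) (p : D) :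
    postMean m k s L p = m p + (fun i => k p (q i)) ⬝ᵥ
      ((noisyGram k s q)⁻¹ *ᵥ fun i => y i - m (q i)) := by
  subst hL
  have h' : ∀ i, L.get i = (q i, y i) := h
  have h₁ : crossVec k L p = fun i => k p (q i) := funext fun i => by simp only [crossVec, h']
  have h₂ : residualVec m L = fun i => y i - m (q i) :=
    funext fun i => by simp only [residualVec, h']
  simp only [postMean, noisyGram, gramMatrix, h₁, h₂, h']

theorem postVar_eq_of_get (s : ℝ) {n : ℕ} (q : Fin n → D) (y : Fin n → ℝ) {L : List (D × ℝ)}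
    (hL : L.length = n) (h : ∀ i : Fin n, L.get (Fin.cast hL.symm i) = (q i, y i)) (p : D) :
    postVar k s L p = k p p - (fun i => k p (q i)) ⬝ᵥ
      ((noisyGram k s q)⁻¹ *ᵥ fun i => k p (q i)) := by
  subst hL
  have h' : ∀ i, L.get i = (q i, y i) := h
  have h₁ : crossVec k L p = fun i => k p (q i) := funext fun i => by simp only [crossVec, h']
  simp only [postVar, noisyGram, gramMatrix, h₁, h']

theorem IsGP.memLp_two (hg : IsGP P g m k) (p : D) : MemLp (g p) 2 P :=
  (hg.1.hasGaussianLaw_eval p).memLp_two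

theorem IsGP.cov_comm (hg : IsGP P g m k) (p q : D) : k p q = k q p := by
  rw [← hg.2.2 p q, ← hg.2.2 q p, covariance_comm]

/-- The quadratic form of `K` at `x` is the variance of `∑ x i * g (q i)`, so `K` is positive
semidefinite even with repeated points; adding `s² I` makes it definite. -/
theorem IsGP.isUnit_noisyGram (hg : IsGP P g m k) {s : ℝ} (hs : 0 < s) {n : ℕ} (q : Fin n → D) :
    IsUnit (noisyGram k s q) := by
  have := hg.1.isProbabilityMeasure
  refine Matrix.PosDef.isUnit (Matrix.PosDef.posSemidef_add ?_ ?_)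
  · refine Matrix.PosSemidef.of_dotProduct_mulVec_nonneg ?_ fun x => ?_
    · ext i j
      simpa using hg.cov_comm (q j) (q i)
    · have h : cov[fun ω => ∑ i, x i * g (q i) ω, fun ω => ∑ j, x j * g (q j) ω; P]
          = star x ⬝ᵥ (Matrix.of (fun i j => k (q i) (q j)) *ᵥ x) := by
        rw [covariance_fun_sum_fun_sum (fun i => (hg.memLp_two _).const_mul _)
          (fun i => (hg.memLp_two _).const_mul _)]
        simp only [covariance_const_mul_left, covariance_const_mul_right, hg.2.2, dotProduct,
          Matrix.mulVec, Matrix.of_apply, star_trivial, Finset.mul_sum]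
        exact Finset.sum_congr rfl fun i _ => Finset.sum_congr rfl fun j _ => by ring
      rw [← h, covariance_self]
      · exact variance_nonneg _ _
      · exact (memLp_finsetSum _ fun i _ => (hg.memLp_two (q i)).const_mul (x i)).aestronglyMeasurable.aemeasurable
  · exact Matrix.PosDef.one.smul (by positivity)

variable [Fintype D] {n : ℕ} {e : Fin n → Ω → ℝ} {s : ℝ≥0}

/-- Noisy observations of a Gaussian process at fixed points are independent of the deviation of
the process from its posterior mean, which is Gaussian with the posterior variance. -/
theorem IsGP.residual (hg : IsGP P g m k) (hs : 0 < s) (he : iIndepFun e P)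
    (hlaw : ∀ i, P.map (e i) = gaussianReal 0 (s ^ 2))
    (hme : ∀ i, AEMeasurable (e i) P)
    (hge : IndepFun (fun ω p => g p ω) (fun ω i => e i ω) P) (q : Fin n → D) (p : D)
    {b : ℝ} (hb : 0 ≤ b) :
    let ρ : Ω → ℝ := fun ω => g p ω - (m p + (fun i => k p (q i)) ⬝ᵥ
      ((noisyGram k s q)⁻¹ *ᵥ fun i => g (q i) ω + e i ω - m (q i)))
    IndepFun ρ (fun ω i => g (q i) ω + e i ω) P ∧
    P.real {ω | ρ ω < -(b * √(k p p - (fun i => k p (q i)) ⬝ᵥ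
      ((noisyGram k s q)⁻¹ *ᵥ fun i => k p (q i))))} ≤ Real.exp (-b ^ 2 / 2) := by
  intro ρ
  have hP := hg.1.isProbabilityMeasure
  set A := noisyGram k s q with hA
  set c : Fin n → ℝ := fun i => k p (q i) with hc
  -- Weights of the best linear predictor: `w ᵥ* A = c` says exactly that the prediction error `ρ₀`
  -- is uncorrelated with every `y j`.
  set w : Fin n → ℝ := c ᵥ* A⁻¹ with hw
  set y : Fin n → Ω → ℝ := fun i ω => g (q i) ω + e i ω with hy
  set ρ₀ : Ω → ℝ := fun ω => g p ω - ∑ i, w i * y i ω with hρ₀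
  have hwA : w ᵥ* A = c := by
    rw [hw, Matrix.vecMul_vecMul, Matrix.nonsing_inv_mul _
      ((Matrix.isUnit_iff_isUnit_det _).1 (hg.isUnit_noisyGram (by exact_mod_cast hs) q)),
      Matrix.vecMul_one]
  have heG : ∀ i, HasGaussianLaw (e i) P := fun i => ⟨by rw [hlaw i]; infer_instance⟩
  have hgvec : HasGaussianLaw (fun ω p => g p ω) P := by
    let r : ({d // d ∈ (Finset.univ : Finset D)} → ℝ) →L[ℝ] (D → ℝ) :=
      ContinuousLinearMap.pi fun d =>
        ContinuousLinearMap.proj (⟨d, Finset.mem_univ d⟩ : {d // d ∈ (Finset.univ : Finset D)})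
    exact (hg.1.hasGaussianLaw Finset.univ).map r
  have hjoint : HasGaussianLaw (fun ω => (fun p => g p ω, fun i => e i ω)) P :=
    hge.hasGaussianLaw hgvec (he.hasGaussianLaw heG)
  have hge' : ∀ d i, cov[g d, e i; P] = 0 := fun d i =>
    (hge.comp (measurable_pi_apply d) (measurable_pi_apply i)).covariance_eq_zero
      (hg.memLp_two d) (heG i).memLp_two
  have hee : ∀ i j, cov[e i, e j; P] = (s : ℝ) ^ 2 * (1 : Matrix (Fin n) (Fin n) ℝ) i j := by
    intro i j
    by_cases hij : i = j
    · subst hij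
      rw [covariance_self (hme i), ← variance_id_map (hme i), hlaw i, variance_id_gaussianReal]
      simp
    · rw [(he.indepFun hij).covariance_eq_zero (heG i).memLp_two (heG j).memLp_two]
      simp [hij]
  have hyL : ∀ i, MemLp (y i) 2 P := fun i => (hg.memLp_two _).add (heG i).memLp_two
  have hgy : ∀ d j, cov[g d, y j; P] = k d (q j) := fun d j => by
    change cov[g d, g (q j) + e j; P] = _
    rw [covariance_add_right (hg.memLp_two _) (hg.memLp_two _) (heG j).memLp_two, hge', hg.2.2,
      add_zero]
  have hyy : ∀ i j, cov[y i, y j; P] = A i j := fun i j => by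
    change cov[g (q i) + e i, y j; P] = _
    rw [covariance_add_left (hg.memLp_two _) (heG i).memLp_two (hyL j), hgy]
    change _ + cov[e i, g (q j) + e j; P] = _
    rw [covariance_add_right (heG i).memLp_two (hg.memLp_two _) (heG j).memLp_two,
      covariance_comm, hge', hee]
    simp [hA, noisyGram]
  have hsumL : MemLp (fun ω => ∑ i, w i * y i ω) 2 P :=
    memLp_finsetSum _ fun i _ => (hyL i).const_mul (w i)
  have hρL : MemLp ρ₀ 2 P := (hg.memLp_two p).sub hsumL
  have hcov : ∀ {Y : Ω → ℝ}, MemLp Y 2 P →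
      cov[ρ₀, Y; P] = cov[g p, Y; P] - ∑ i, w i * cov[y i, Y; P] := by
    intro Y hY
    rw [hρ₀, covariance_fun_sub_left (hg.memLp_two p) hsumL hY,
      covariance_fun_sum_left (fun i => (hyL i).const_mul (w i)) hY]
    simp only [covariance_const_mul_left]
  have hρy : ∀ j, cov[ρ₀, y j; P] = 0 := fun j => by
    rw [hcov (hyL j), hgy]
    simp only [hyy]
    rw [sub_eq_zero]
    exact (congrFun hwA j).symm
  -- By orthogonality to the observations, `Var[ρ₀]` reduces to `cov[ρ₀, g p]`.
  have hvar : Var[ρ₀; P] = k p p - c ⬝ᵥ (A⁻¹ *ᵥ c) := by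
    rw [← covariance_self hρL.aestronglyMeasurable.aemeasurable, hcov hρL, covariance_comm,
      hcov (hg.memLp_two p), hg.2.2, Matrix.dotProduct_mulVec]
    simp only [covariance_comm _ ρ₀, hρy, mul_zero, Finset.sum_const_zero, sub_zero,
      covariance_comm (y _) (g p), hgy]
    rfl
  have hdet : ρ = fun ω => ρ₀ ω + (-m p + ∑ i, w i * m (q i)) := by
    funext ω
    change g p ω - (m p + c ⬝ᵥ (A⁻¹ *ᵥ fun i => y i ω - m (q i))) = _
    rw [Matrix.dotProduct_mulVec, ← hw]
    simp only [hρ₀, dotProduct, mul_sub, Finset.sum_sub_distrib]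
    ring
  -- Zero covariance yields independence only under joint Gaussianity, which holds because `ρ₀` and
  -- `y` are linear images of the process and the noises. The index `Unit` presents `ρ₀` as a
  -- one-element family.
  have hlin : HasGaussianLaw (fun ω => (fun _ : Unit => ρ₀ ω, fun i => y i ω)) P := by
    let T : ((D → ℝ) × (Fin n → ℝ)) →ₗ[ℝ] (Unit → ℝ) × (Fin n → ℝ) :=
      { toFun := fun z => (fun _ => z.1 p - ∑ i, w i * (z.1 (q i) + z.2 i),
          fun i => z.1 (q i) + z.2 i)
        map_add' := fun z z' => by
          ext i
          · simp only [Prod.fst_add, Prod.snd_add, Pi.add_apply, mul_add, Finset.sum_add_distrib]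
            ring
          · simp only [Prod.fst_add, Prod.snd_add, Pi.add_apply]
            ring
        map_smul' := fun a z => by
          ext i
          · simp only [Prod.smul_fst, Prod.smul_snd, Pi.smul_apply, smul_eq_mul, mul_sub,
              RingHom.id_apply, Finset.mul_sum, mul_add, mul_left_comm a]
          · simp only [Prod.smul_fst, Prod.smul_snd, Pi.smul_apply, smul_eq_mul, mul_add,
              RingHom.id_apply] }
    exact hjoint.map (LinearMap.toContinuousLinearMap T)
  have hρG : HasGaussianLaw ρ₀ P := hlin.fst.eval ()
  have hmean : P[ρ] = 0 := by
    have hym : ∀ i, P[y i] = m (q i) := fun i => by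
      have : P[e i] = 0 := by
        rw [← integral_map (hme i) (f := fun x => x) (by fun_prop), hlaw i,
          integral_id_gaussianReal]
      change ∫ ω, g (q i) ω + e i ω ∂P = _
      rw [integral_add ((hg.memLp_two _).integrable one_le_two)
        ((heG i).memLp_two.integrable one_le_two), hg.2.1, this, add_zero]
    rw [hdet, integral_add (hρL.integrable one_le_two) (integrable_const _), hρ₀,
      integral_sub ((hg.memLp_two _).integrable one_le_two) (hsumL.integrable one_le_two),
      integral_finsetSum _ fun i _ => ((hyL i).const_mul (w i)).integrable one_le_two, hg.2.1]
    simp only [integral_const_mul, hym, integral_const, probReal_univ, one_smul]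
    ring
  have hρG' : HasGaussianLaw ρ P := by
    refine ⟨?_⟩
    have := hρG.isGaussian_map
    have hmap : P.map ρ = (P.map ρ₀).map (· + (-m p + ∑ i, w i * m (q i))) := by
      rw [AEMeasurable.map_map_of_aemeasurable (by fun_prop) hρG.aemeasurable, hdet]
      rfl
    rw [hmap]
    infer_instance
  have hvar' : Var[ρ; P] = k p p - c ⬝ᵥ (A⁻¹ *ᵥ c) := by
    rw [hdet, variance_add_const hρG.aemeasurable.aestronglyMeasurable, hvar]
  refine ⟨?_, ?_⟩
  · have hind := hlin.indepFun_of_covariance_eval (X := fun _ => ρ₀) fun _ j => hρy j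
    rw [hdet]
    exact hind.comp (φ := fun x : Unit → ℝ => x () + (-m p + ∑ i, w i * m (q i))) (by fun_prop)
      measurable_id
  · rw [← hvar']
    exact hρG'.measure_lt_neg_mul_sqrt_variance_le hmean hb

end Residual

/-! ### Traces of σ-algebras -/

/-- The σ-algebra of the sets whose intersection with `E` is measurable. -/
@[reducible] def MeasurableSpace.traceOn {Ω : Type*} (M : MeasurableSpace Ω) (E : Set Ω)
    (hE : MeasurableSet[M] E) : MeasurableSpace Ω where
  MeasurableSet' A := MeasurableSet[M] (A ∩ E)
  measurableSet_empty := by simp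
  measurableSet_compl A hA := by
    have : Aᶜ ∩ E = E \ (A ∩ E) := by ext; simp; tauto
    rw [this]
    exact hE.diff hA
  measurableSet_iUnion A hA := by
    rw [Set.iUnion_inter]
    exact MeasurableSet.iUnion hA

/-- Actual and frozen observations agree only on the design event; this transfers measurability from
one to the other there. -/
theorem MeasurableSpace.comap_le_traceOn {Ω β : Type*} [MeasurableSpace β] {M : MeasurableSpace Ω}
    {E : Set Ω} (hE : MeasurableSet[M] E) {u v : Ω → β} (hv : Measurable[M] v)
    (huv : ∀ ω ∈ E, u ω = v ω) : MeasurableSpace.comap u inferInstance ≤ M.traceOn E hE := by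
  rintro _ ⟨B, hB, rfl⟩
  have : u ⁻¹' B ∩ E = v ⁻¹' B ∩ E := by
    ext ω
    simp only [Set.mem_inter_iff, Set.mem_preimage]
    exact ⟨fun h => ⟨huv ω h.2 ▸ h.1, h.2⟩, fun h => ⟨(huv ω h.2).symm ▸ h.1, h.2⟩⟩
  change MeasurableSet[M] (u ⁻¹' B ∩ E)
  rw [this]
  exact (hv hB).inter hE

namespace QueryRun

variable {Ω ι D : Type*}

/-! ### Sources of randomness -/

section Sources

variable {R : QueryRun Ω ι D}

/-- The noise variables of the observations of `h`, initial or not. -/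
def noiseOf (R : QueryRun Ω ι D) (h : ι) : Fin (R.n₀ h) ⊕ ℕ → Ω → ℝ :=
  Sum.elim (R.ε₀ h) fun t => R.ε t h

/-- The labels of the noise variables of the observations of `h`. -/
def noiseSource (R : QueryRun Ω ι D) (h : ι) : Fin (R.n₀ h) ⊕ ℕ → Source ι R.n₀ :=
  Sum.elim (.initialNoise h) fun t => .noise t h

theorem noiseSource_injective (R : QueryRun Ω ι D) (h : ι) :
    Function.Injective (R.noiseSource h) := by
  rintro (i | i) (j | j) hij <;> simp_all [noiseSource]

theorem sourceAlgebra_noiseSource (h : ι) (l) :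
    R.sourceAlgebra (R.noiseSource h l) = MeasurableSpace.comap (R.noiseOf h l) inferInstance := by
  cases l <;> rfl

theorem measurable_g_sourceAlgebra (h : ι) (p : D) :
    Measurable[R.sourceAlgebra (.function h)] (R.g h p) :=
  (measurable_pi_apply p).comp (comap_measurable fun ω p => R.g h p ω)

variable [mΩ : MeasurableSpace Ω] {P : Measure Ω} {m : ι → D → ℝ} {k : ι → D → D → ℝ} {σn : ℝ≥0}

theorem IsModel.sourceAlgebra_le (hmodel : R.IsModel P m k σn) (a : Source ι R.n₀) :
    R.sourceAlgebra a ≤ mΩ := by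
  cases a with
  | seed => exact hmodel.seed_le
  | function h => exact (measurable_pi_iff.2 fun p => hmodel.measurable_g h p).comap_le
  | initialNoise h i => exact (hmodel.measurable_ε₀ h i).comap_le
  | noise t h => exact (hmodel.measurable_ε t h).comap_le

theorem IsModel.measurable_noiseOf (hmodel : R.IsModel P m k σn) (h : ι) (l) :
    Measurable (R.noiseOf h l) := by
  cases l with
  | inl i => exact hmodel.measurable_ε₀ h i
  | inr t => exact hmodel.measurable_ε t h

theorem IsModel.law_noiseOf (hmodel : R.IsModel P m k σn) (h : ι) (l) :
    P.map (R.noiseOf h l) = gaussianReal 0 (σn ^ 2) := by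
  cases l with
  | inl i => exact hmodel.law_ε₀ h i
  | inr t => exact hmodel.law_ε t h

end Sources

/-! ### Runs with a fixed design -/

/-- The run in which the design is replaced by the deterministic one given by `d` and `s`. -/
def freeze (R : QueryRun Ω ι D) (d : (h : ι) → Fin (R.n₀ h) → D) (s : ℕ → D × Finset ι) :
    QueryRun Ω ι D :=
  { R with x₀ := fun h i _ => d h i, x := fun t _ => (s t).1, Q := fun t _ => (s t).2 }

/-- The event that the design of the first `t` rounds is the one given by `d` and `s`. -/
def designEvent (R : QueryRun Ω ι D) (d : (h : ι) → Fin (R.n₀ h) → D) (s : ℕ → D × Finset ι)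
    (t : ℕ) : Set Ω :=
  {ω | (∀ h i, R.x₀ h i ω = d h i) ∧
    ∀ i < t, R.x (i + 1) ω = (s (i + 1)).1 ∧ R.Q (i + 1) ω = (s (i + 1)).2}

variable {R : QueryRun Ω ι D} {d : (h : ι) → Fin (R.n₀ h) → D} {s : ℕ → D × Finset ι}

theorem designEvent_succ_subset (t : ℕ) : R.designEvent d s (t + 1) ⊆ R.designEvent d s t :=
  fun _ h => ⟨h.1, fun i hi => h.2 i (hi.trans t.lt_succ_self)⟩

theorem initialObs_freeze {t : ℕ} {ω : Ω} (hω : ω ∈ R.designEvent d s t) (h : ι)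
    (i : Fin (R.n₀ h)) : R.initialObs h i ω = (R.freeze d s).initialObs h i ω := by
  simp only [initialObs, freeze, hω.1 h i]

theorem obs_freeze {t : ℕ} {ω : Ω} (hω : ω ∈ R.designEvent d s (t + 1)) (h : ι) :
    R.obs (t + 1) h ω = (R.freeze d s).obs (t + 1) h ω := by
  simp only [obs, freeze, (hω.2 t t.lt_succ_self).1]

variable [DecidableEq ι]

theorem data_freeze (h : ι) {t : ℕ} {ω : Ω} (hω : ω ∈ R.designEvent d s t) :
    R.data h t ω = (R.freeze d s).data h t ω := by
  induction t with
  | zero =>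
    simp only [data, initialObs_freeze hω]
    simp only [freeze, hω.1 h]
  | succ t ih =>
    simp only [data, ih (designEvent_succ_subset t hω), obs_freeze hω]
    simp only [freeze, (hω.2 t t.lt_succ_self).1, (hω.2 t t.lt_succ_self).2]
    rfl

theorem measurable_initialObs_history (R : QueryRun Ω ι D) (h : ι) (i : Fin (R.n₀ h)) :
    Measurable[R.history 0] (R.initialObs h i) :=
  measurable_iff_comap_le.2 <| (le_iSup₂ (f := fun h i =>
    MeasurableSpace.comap (R.initialObs h i) inferInstance) h i).trans
      (le_sup_right : _ ≤ R.seed ⊔ _)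

theorem measurable_obs_history (R : QueryRun Ω ι D) (t : ℕ) (h : ι) :
    Measurable[R.history (t + 1)]
      (fun ω => if h ∈ R.Q (t + 1) ω then R.obs (t + 1) h ω else 0) :=
  measurable_iff_comap_le.2 <| (le_iSup (fun h => MeasurableSpace.comap
    (fun ω => if h ∈ R.Q (t + 1) ω then R.obs (t + 1) h ω else 0) inferInstance) h).trans
      (le_sup_right : _ ≤ R.history t ⊔ _)

/-- The two claims feed each other in the induction: on the event that the past design is the
prescribed one, actual history is frozen history, and the next query is determined by actual
history. -/
theorem measurableSet_designEvent [Finite ι] [MeasurableSpace D] [MeasurableSingletonClass D]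
    (hR : R.NonAnticipating) (t : ℕ) :
    MeasurableSet[(R.freeze d s).history t] (R.designEvent d s t) ∧
    ∀ A, MeasurableSet[R.history t] A →
      MeasurableSet[(R.freeze d s).history t] (A ∩ R.designEvent d s t) := by
  induction t with
  | zero =>
    have hE : MeasurableSet[(R.freeze d s).history 0] (R.designEvent d s 0) := by
      have : R.designEvent d s 0 = ⋂ h, ⋂ i, R.x₀ h i ⁻¹' {d h i} := by
        ext; simp [designEvent]
      rw [this]
      exact MeasurableSet.iInter fun h => MeasurableSet.iInter fun i =>
        (le_sup_left : R.seed ≤ (R.freeze d s).history 0) _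
          (hR.1 h i (measurableSet_singleton _))
    refine ⟨hE, fun A hA => ?_⟩
    suffices R.history 0 ≤ MeasurableSpace.traceOn _ _ hE from this A hA
    refine sup_le (fun B hB => ?_) (iSup_le fun h => iSup_le fun i => ?_)
    · exact MeasurableSet.inter ((le_sup_left : R.seed ≤ (R.freeze d s).history 0) _ hB) hE
    · exact MeasurableSpace.comap_le_traceOn hE
        ((R.freeze d s).measurable_initialObs_history h i) fun ω hω => initialObs_freeze hω h i
  | succ t ih =>
    have hle : (R.freeze d s).history t ≤ (R.freeze d s).history (t + 1) := le_sup_left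
    have hE : MeasurableSet[(R.freeze d s).history (t + 1)] (R.designEvent d s (t + 1)) := by
      have : R.designEvent d s (t + 1) =
          (R.x (t + 1) ⁻¹' {(s (t + 1)).1} ∩
            ⋂ h, {ω | h ∈ R.Q (t + 1) ω ↔ h ∈ (s (t + 1)).2}) ∩ R.designEvent d s t := by
        ext ω
        simp only [designEvent, Set.mem_inter_iff, Set.mem_preimage, Set.mem_singleton_iff,
          Set.mem_iInter, Set.mem_ofPred_eq, ← Finset.ext_iff, Nat.forall_lt_succ_right]
        tauto
      rw [this]
      refine hle _ (ih.2 _ (MeasurableSet.inter (hR.2.1 t (measurableSet_singleton _))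
        (MeasurableSet.iInter fun h => ?_)))
      by_cases hh : h ∈ (s (t + 1)).2
      · simpa only [hh, iff_true] using hR.2.2 t h
      · simp only [hh, iff_false]
        exact (hR.2.2 t h).compl
    refine ⟨hE, fun A hA => ?_⟩
    suffices R.history (t + 1) ≤ MeasurableSpace.traceOn _ _ hE from this A hA
    refine sup_le (fun B hB => ?_) (iSup_le fun h => ?_)
    · have : B ∩ R.designEvent d s (t + 1) =
          (B ∩ R.designEvent d s t) ∩ R.designEvent d s (t + 1) := by
        rw [Set.inter_assoc, Set.inter_eq_self_of_subset_right (designEvent_succ_subset t)]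
      change MeasurableSet[(R.freeze d s).history (t + 1)] (B ∩ R.designEvent d s (t + 1))
      rw [this]
      exact MeasurableSet.inter (hle _ (ih.2 B hB)) hE
    · refine MeasurableSpace.comap_le_traceOn hE
        ((R.freeze d s).measurable_obs_history t h) fun ω hω => ?_
      rw [obs_freeze hω]
      simp only [freeze, (hω.2 t t.lt_succ_self).2]
      rfl

/-! ### The data set of one function in a run with a fixed design -/

/-- The points at which `h` is observed in the first `t` rounds of the fixed design given by `d`
and `s`, with the labels of the noise variables. -/
def frozenInputs (R : QueryRun Ω ι D) (d : (h : ι) → Fin (R.n₀ h) → D) (s : ℕ → D × Finset ι)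
    (h : ι) : ℕ → List (D × (Fin (R.n₀ h) ⊕ ℕ))
  | 0 => List.ofFn fun i => (d h i, Sum.inl i)
  | t + 1 => R.frozenInputs d s h t ++
      if h ∈ (s (t + 1)).2 then [((s (t + 1)).1, Sum.inr (t + 1))] else []

theorem data_freeze_eq_map (h : ι) (t : ℕ) (ω : Ω) :
    (R.freeze d s).data h t ω = (R.frozenInputs d s h t).map
      fun z => (z.1, R.g h z.1 ω + R.noiseOf h z.2 ω) := by
  induction t with
  | zero => simp only [data, frozenInputs, List.map_ofFn]; rfl
  | succ t ih =>
    simp only [data, frozenInputs, List.map_append, ih]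
    by_cases hh : h ∈ (s (t + 1)).2
    · simp [freeze, hh, obs, noiseOf]
    · simp [freeze, hh]

/-- Points may repeat but noise labels may not, which is what makes the noises in one data set
independent. The bound on round labels shows that each new label is fresh. -/
theorem frozenInputs_nodup (h : ι) (t : ℕ) :
    ((R.frozenInputs d s h t).map Prod.snd).Nodup ∧
      ∀ j, Sum.inr j ∈ (R.frozenInputs d s h t).map Prod.snd → j ≤ t := by
  induction t with
  | zero =>
    simp only [frozenInputs, List.map_ofFn]
    refine ⟨List.nodup_ofFn.2 fun i j hij => by simpa using hij, fun j hj => ?_⟩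
    simp [List.mem_ofFn] at hj
  | succ t ih =>
    simp only [frozenInputs, List.map_append]
    by_cases hh : h ∈ (s (t + 1)).2
    · simp only [hh, if_true, List.map_cons, List.map_nil]
      refine ⟨List.nodup_append'.2 ⟨ih.1, by simp, ?_⟩, fun j hj => ?_⟩
      · rw [List.disjoint_singleton]
        exact fun hmem => absurd (ih.2 _ hmem) (by omega)
      · rcases List.mem_append.1 hj with hj | hj
        · exact (ih.2 j hj).trans t.le_succ
        · simp at hj
          omega
    · simp only [hh, if_false, List.map_nil, List.append_nil]
      exact ⟨ih.1, fun j hj => (ih.2 j hj).trans t.le_succ⟩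

/-- In a run with a fixed design, what is known after `t` rounds is generated by the observations
of `h`, the internal randomness, the other functions and their noises. -/
theorem history_freeze_le (h : ι) (M : MeasurableSpace Ω) (hseed : R.seed ≤ M)
    (hg : ∀ h' ≠ h, ∀ p, Measurable[M] (R.g h' p))
    (hε₀ : ∀ h' ≠ h, ∀ i, Measurable[M] (R.ε₀ h' i))
    (hε : ∀ h' ≠ h, ∀ t, Measurable[M] (R.ε t h')) (t : ℕ)
    (hy : ∀ z ∈ R.frozenInputs d s h t,
      Measurable[M] fun ω => R.g h z.1 ω + R.noiseOf h z.2 ω) :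
    (R.freeze d s).history t ≤ M := by
  induction t with
  | zero =>
    refine sup_le hseed (iSup_le fun h' => iSup_le fun i => measurable_iff_comap_le.1 ?_)
    by_cases hh : h' = h
    · subst hh
      exact hy (d h' i, Sum.inl i) (by
        simp only [frozenInputs, List.mem_ofFn]
        exact ⟨i, rfl⟩)
    · exact (hg h' hh _).add (hε₀ h' hh i)
  | succ t ih =>
    refine sup_le (ih fun z hz => hy z (List.mem_append_left _ hz))
      (iSup_le fun h' => measurable_iff_comap_le.1 ?_)
    change Measurable[M] fun ω => if h' ∈ (s (t + 1)).2 then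
      R.g h' (s (t + 1)).1 ω + R.ε (t + 1) h' ω else 0
    by_cases hs : h' ∈ (s (t + 1)).2
    · simp only [hs, if_true]
      by_cases hh : h' = h
      · subst hh
        exact hy ((s (t + 1)).1, Sum.inr (t + 1)) (by simp [frozenInputs, hs])
      · exact (hg h' hh _).add (hε h' hh _)
    · simp only [hs, if_false]
      exact measurable_const

/-! ### Confidence bounds -/

section Confidence

variable [mΩ : MeasurableSpace Ω] {P : Measure Ω} [IsProbabilityMeasure P]
  {m : ι → D → ℝ} {k : ι → D → D → ℝ} {σn : ℝ≥0}

/-- For each fixed design, the event that `g h p` falls below its lower confidence bound has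
conditional probability at most `exp (-b ^ 2 / 2)` given that the design is realized. -/
theorem IsModel.measureReal_lt_lcb_inter_designEvent_le [Fintype D] [Finite ι] [MeasurableSpace D]
    [MeasurableSingletonClass D] (hmodel : R.IsModel P m k σn) (hσn : 0 < σn)
    (hquery : R.NonAnticipating) (h : ι) (t : ℕ) (p : D) {b : ℝ} (hb : 0 ≤ b)
    (d : (h : ι) → Fin (R.n₀ h) → D) (s : ℕ → D × Finset ι) :
    MeasurableSet (R.designEvent d s t) ∧
    P.real ({ω | R.g h p ω < R.mu m k σn h t p ω - b * R.sd k σn h t p ω} ∩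
      R.designEvent d s t) ≤ Real.exp (-b ^ 2 / 2) * P.real (R.designEvent d s t) := by
  set S := R.frozenInputs d s h t with hS
  let q : Fin S.length → D := fun i => (S.get i).1
  let l : Fin S.length → Fin (R.n₀ h) ⊕ ℕ := fun i => (S.get i).2
  let e : Fin S.length → Ω → ℝ := fun i => R.noiseOf h (l i)
  let y : Ω → Fin S.length → ℝ := fun ω i => R.g h (q i) ω + e i ω
  have hl : Function.Injective l := by
    have := (frozenInputs_nodup (R := R) (d := d) (s := s) h t).1
    rw [← hS, List.nodup_iff_injective_get] at this
    intro i j hij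
    have hlen : S.length = (S.map Prod.snd).length := List.length_map _ |>.symm
    have h' := @this (Fin.cast hlen i) (Fin.cast hlen j) (by simpa [l] using hij)
    simpa using h'
  -- the sources of randomness of the observations of `h`
  have hle := hmodel.sourceAlgebra_le
  let N : Set (Source ι R.n₀) := Set.range (R.noiseSource h)
  let V : Set (Source ι R.n₀) := insert (.function h) N
  have hfN : Disjoint {Source.function h} N := by
    rw [Set.disjoint_singleton_left]
    rintro ⟨i | i, hi⟩ <;> simp [noiseSource] at hi
  have hVle : ⨆ a ∈ V, R.sourceAlgebra a ≤ mΩ := iSup₂_le fun a _ => hle a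
  have hWle : ⨆ a ∈ Vᶜ, R.sourceAlgebra a ≤ mΩ := iSup₂_le fun a _ => hle a
  have hVW := indep_iSup_of_disjoint hle hmodel.indep (disjoint_compl_right (a := V))
  have hgV : ∀ p, Measurable[⨆ a ∈ V, R.sourceAlgebra a] (R.g h p) := fun p =>
    (measurable_g_sourceAlgebra h p).mono
      (le_iSup₂_of_le _ (Set.mem_insert _ _) le_rfl) le_rfl
  have heV : ∀ i, Measurable[⨆ a ∈ V, R.sourceAlgebra a] (e i) := fun i =>
    measurable_iff_comap_le.2 <| (sourceAlgebra_noiseSource h (l i)).symm.le.trans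
      (le_iSup₂_of_le _ (Set.mem_insert_of_mem _ ⟨l i, rfl⟩) le_rfl)
  have hyV : Measurable[⨆ a ∈ V, R.sourceAlgebra a] y :=
    @measurable_pi_lambda _ _ _ (_) _ _ fun i => (hgV (q i)).add (heV i)
  have hei : iIndepFun e P := by
    rw [iIndepFun_iff_iIndep]
    have := hmodel.indep.precomp ((R.noiseSource_injective h).comp hl)
    convert this using 2 with i
    exact (sourceAlgebra_noiseSource h (l i)).symm
  have hge : IndepFun (fun ω p => R.g h p ω) (fun ω i => e i ω) P := by
    have := indep_iSup_of_disjoint hle hmodel.indep hfN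
    refine indep_of_indep_of_le_left (indep_of_indep_of_le_right this ?_) ?_
    · refine measurable_iff_comap_le.1 (@measurable_pi_lambda _ _ _ (_) _ _ fun i => ?_)
      exact measurable_iff_comap_le.2 <| (sourceAlgebra_noiseSource h (l i)).symm.le.trans
        (le_iSup₂_of_le (R.noiseSource h (l i)) ⟨l i, rfl⟩ le_rfl)
    · exact le_iSup₂_of_le (Source.function h) rfl le_rfl
  obtain ⟨hρy, hρ⟩ := (hmodel.prior h).residual hσn hei (fun i => hmodel.law_noiseOf h _)
    (fun i => (hmodel.measurable_noiseOf h _).aemeasurable) hge q p hb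
  set ρ : Ω → ℝ := fun ω => R.g h p ω - (m h p + (fun i => k h p (q i)) ⬝ᵥ
      ((noisyGram (k h) σn q)⁻¹ *ᵥ fun i => R.g h (q i) ω + e i ω - m h (q i))) with hρdef
  have hρV : Measurable[⨆ a ∈ V, R.sourceAlgebra a] ρ := by
    refine (hgV p).sub (measurable_const.add ?_)
    simp only [dotProduct, Matrix.mulVec]
    exact Finset.measurable_sum _ fun i _ => measurable_const.mul
      (Finset.measurable_sum _ fun j _ => measurable_const.mul
        (((hgV (q j)).add (heV j)).sub measurable_const))
  -- `ρ` is independent of `y`, and both are functions of the sources in `V`, hence jointly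
  -- independent of the remaining ones. So `ρ` is independent of everything the design can depend
  -- on.
  have hind : Indep (MeasurableSpace.comap ρ inferInstance)
      (MeasurableSpace.comap y inferInstance ⊔ ⨆ a ∈ Vᶜ, R.sourceAlgebra a) P :=
    Indep.sup_right_of_sup_left (hρV.comap_le.trans hVle) (hyV.comap_le.trans hVle) hWle hρy
      (indep_of_indep_of_le_left hVW (sup_le hρV.comap_le hyV.comap_le))
  have hhist : (R.freeze d s).history t ≤
      MeasurableSpace.comap y inferInstance ⊔ ⨆ a ∈ Vᶜ, R.sourceAlgebra a := by
    have hW : ∀ a ∉ V, R.sourceAlgebra a ≤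
        MeasurableSpace.comap y inferInstance ⊔ ⨆ a ∈ Vᶜ, R.sourceAlgebra a := fun a ha =>
      (le_iSup₂ (f := fun a (_ : a ∈ Vᶜ) => R.sourceAlgebra a) a ha).trans le_sup_right
    have hnot : ∀ h' ≠ h, ∀ i, R.noiseSource h' i ∉ V := by
      rintro h' hh i (hi | ⟨j, hi⟩)
      · cases i <;> simp [noiseSource] at hi
      · rcases i with i | i <;> rcases j with j | j <;> simp [noiseSource] at hi
        · exact hh hi.1.symm
        · exact hh hi.2.symm
    refine history_freeze_le h _ (hW .seed ?_) (fun h' hh p => ?_) (fun h' hh i => ?_)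
      (fun h' hh i => ?_) t fun z hz => ?_
    · rintro (hi | ⟨i | i, hi⟩)
      · simp at hi
      all_goals simp [noiseSource] at hi
    · refine (measurable_g_sourceAlgebra h' p).mono (hW _ ?_) le_rfl
      rintro (hi | ⟨i | i, hi⟩)
      · simp at hi
        exact hh hi
      all_goals simp [noiseSource] at hi
    · exact measurable_iff_comap_le.2 (hW (R.noiseSource h' (Sum.inl i)) (hnot h' hh _))
    · exact measurable_iff_comap_le.2 (hW (R.noiseSource h' (Sum.inr i)) (hnot h' hh _))
    · obtain ⟨i, rfl⟩ := List.get_of_mem hz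
      exact Measurable.mono ((measurable_pi_apply i).comp (comap_measurable y)) le_sup_left le_rfl
  have hE := (measurableSet_designEvent (d := d) (s := s) hquery t).1
  refine ⟨sup_le (hyV.comap_le.trans hVle) hWle _ (hhist _ hE), ?_⟩
  set v : ℝ := k h p p - (fun i => k h p (q i)) ⬝ᵥ
    ((noisyGram (k h) σn q)⁻¹ *ᵥ fun i => k h p (q i)) with hv
  -- On the design event the posterior standard deviation is the constant `√v`, so failure is an
  -- event about `ρ` alone.
  have hsub : {ω | R.g h p ω < R.mu m k σn h t p ω - b * R.sd k σn h t p ω} ∩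
      R.designEvent d s t ⊆ {ω | ρ ω < -(b * √v)} ∩ R.designEvent d s t := by
    rintro ω ⟨hbad, hω⟩
    refine ⟨?_, hω⟩
    have hdata : R.data h t ω = S.map fun z => (z.1, R.g h z.1 ω + R.noiseOf h z.2 ω) := by
      rw [data_freeze h hω, data_freeze_eq_map]
    have hlen : (R.data h t ω).length = S.length := by rw [hdata, List.length_map]
    have hget : ∀ i : Fin S.length,
        (R.data h t ω).get (Fin.cast hlen.symm i) = (q i, R.g h (q i) ω + e i ω) := by
      intro i
      simp only [List.get_eq_getElem, Fin.val_cast, hdata, List.getElem_map]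
      rfl
    have hmu : R.mu m k σn h t p ω = _ := postMean_eq_of_get (m := m h) (k := k h) σn q _ hlen hget p
    have hsd : R.sd k σn h t p ω = √v := by
      rw [sd, postSD, postVar_eq_of_get (k := k h) σn q _ hlen hget p]
    simp only [Set.mem_ofPred_eq, hmu, hsd] at hbad
    simp only [Set.mem_ofPred_eq, hρdef]
    linarith
  have hA : MeasurableSet[MeasurableSpace.comap ρ inferInstance] {ω | ρ ω < -(b * √v)} :=
    ⟨Set.Iio (-(b * √v)), measurableSet_Iio, rfl⟩
  refine (measureReal_mono hsub).trans ?_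
  have hmul : P.real ({ω | ρ ω < -(b * √v)} ∩ R.designEvent d s t) =
      P.real {ω | ρ ω < -(b * √v)} * P.real (R.designEvent d s t) := by
    simp only [Measure.real, (Indep_iff _ _ P).1 hind _ _ hA (hhist _ hE), ENNReal.toReal_mul]
  rw [hmul]
  exact mul_le_mul_of_nonneg_right hρ measureReal_nonneg

/-- At each round and point, the probability that a function falls below its lower confidence bound
of width `b` is at most `exp (-b ^ 2 / 2)`. -/
theorem IsModel.measureReal_lt_lcb_le [Fintype D] [Fintype ι] [MeasurableSpace D]
    [MeasurableSingletonClass D] (hmodel : R.IsModel P m k σn) (hσn : 0 < σn)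
    (hquery : R.NonAnticipating) (h : ι) (t : ℕ) (p : D) {b : ℝ} (hb : 0 ≤ b) :
    P.real {ω | R.g h p ω < R.mu m k σn h t p ω - b * R.sd k σn h t p ω} ≤
      Real.exp (-b ^ 2 / 2) := by
  classical
  set B := {ω | R.g h p ω < R.mu m k σn h t p ω - b * R.sd k σn h t p ω}
  let Δ : Ω → ((h : ι) → Fin (R.n₀ h) → D) × (Fin t → D × Finset ι) := fun ω =>
    (fun h i => R.x₀ h i ω, fun i => (R.x (i + 1) ω, R.Q (i + 1) ω))
  -- Index `i` of `f` stores round `i + 1`. The default `(p, ∅)` is never tested by `designEvent` up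
  -- to `t`.
  let s : (Fin t → D × Finset ι) → ℕ → D × Finset ι := fun f i =>
    if hi : i - 1 < t then f ⟨i - 1, hi⟩ else (p, ∅)
  have hΔ : ∀ z, Δ ⁻¹' {z} = R.designEvent z.1 (s z.2) t := by
    rintro ⟨d, f⟩
    ext ω
    simp only [Set.mem_preimage, Set.mem_singleton_iff, designEvent, Set.mem_ofPred_eq, Δ,
      Prod.mk.injEq, funext_iff]
    refine and_congr_right fun _ => ⟨fun H i hi => ?_, fun H i => ?_⟩
    · have := H ⟨i, hi⟩
      simp only [s, Nat.add_sub_cancel, hi, dif_pos, ← this, and_self]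
    · have := H i i.2
      simp only [s, Nat.add_sub_cancel, i.2, dif_pos, Fin.eta] at this
      exact Prod.ext this.1 this.2
  have key := fun z : ((h : ι) → Fin (R.n₀ h) → D) × (Fin t → D × Finset ι) =>
    hmodel.measureReal_lt_lcb_inter_designEvent_le hσn hquery h t p hb z.1 (s z.2)
  simp only [← hΔ] at key
  -- The fibres of the design map `Δ` partition `Ω`, so their probabilities sum to one.
  calc P.real B ≤ P.real (⋃ z ∈ Finset.univ, B ∩ Δ ⁻¹' {z}) :=
        measureReal_mono (fun ω hω => by simpa using hω) (measure_ne_top _ _)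
    _ ≤ ∑ z, P.real (B ∩ Δ ⁻¹' {z}) := measureReal_biUnion_finset_le _ _
    _ ≤ ∑ z, Real.exp (-b ^ 2 / 2) * P.real (Δ ⁻¹' {z}) :=
        Finset.sum_le_sum fun z _ => (key z).2
    _ = Real.exp (-b ^ 2 / 2) := by
        rw [← Finset.mul_sum, sum_measureReal_preimage_singleton _ fun z _ => (key z).1]
        simp

end Confidence

end QueryRun

/-! ### The union bound -/

/-- The Basel sum `π² / 6`, shifted by one because rounds start at `1`; the dropped term at `0` is
zero. -/
theorem hasSum_six_mul_div_sq_mul_pi_sq (δ : ℝ) :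
    HasSum (fun t : ℕ => 6 * δ / (((t + 1 : ℕ) : ℝ) ^ 2 * Real.pi ^ 2)) δ := by
  have h := ((hasSum_nat_add_iff' 1).2 hasSum_zeta_two).mul_left (6 * δ / Real.pi ^ 2)
  have hpi := Real.pi_ne_zero
  convert! h using 1
  · ext t
    field_simp
  · simp
    field_simp

/-- The logarithm has argument at least `1`, since `π² ≥ 6 > 6δ`. Nonnegativity is what gives `√β ^
2 = β` in the tail bound. -/
theorem betaCoeff_nonneg {nF nX nZ : ℕ} (hF : 0 < nF) (hX : 0 < nX) (hZ : 0 < nZ) {δ : ℝ}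
    (hδ : δ ∈ Set.Ioo (0 : ℝ) 1) {t : ℕ} (ht : 0 < t) : 0 ≤ betaCoeff nF nX nZ δ t := by
  obtain ⟨h0, h1⟩ := hδ
  refine mul_nonneg zero_le_two (Real.log_nonneg ?_)
  rw [one_le_div (by positivity)]
  have hN : (1 : ℝ) ≤ (nF * nX * nZ * t ^ 2 : ℕ) := by
    exact_mod_cast Nat.one_le_iff_ne_zero.2 (by positivity)
  push_cast at hN
  have hpi : (6 : ℝ) ≤ Real.pi ^ 2 := by nlinarith [Real.pi_gt_three]
  nlinarith

theorem exp_neg_betaCoeff_div_two {nF nX nZ : ℕ} (hF : 0 < nF) (hX : 0 < nX) (hZ : 0 < nZ) {δ : ℝ}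
    (hδ : 0 < δ) {t : ℕ} (ht : 0 < t) :
    Real.exp (-betaCoeff nF nX nZ δ t / 2) =
      6 * δ / (t ^ 2 * Real.pi ^ 2) / (nF * nX * nZ) := by
  have hpos : (0 : ℝ) < nF * nX * nZ * t ^ 2 * Real.pi ^ 2 / (6 * δ) := by positivity
  rw [betaCoeff, show ∀ a : ℝ, -(2 * a) / 2 = -a by intro a; ring, Real.exp_neg,
    Real.exp_log hpos, inv_div, div_div]
  congr 1
  ring

theorem QueryRun.constraintRegret_le_of_lcb_le {Ω ι D : Type*} [DecidableEq ι] {R : QueryRun Ω ι D}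
    {m : ι → D → ℝ} {k : ι → D → D → ℝ} {σn : ℝ≥0} {β : ℕ → ℝ} {c : ι} {t : ℕ} {p : D} {ω : Ω}
    (hucb : 0 ≤ R.ucb m k σn β c t p ω)
    (hlcb : R.mu m k σn c (t - 1) p ω - √(β t) * R.sd k σn c (t - 1) p ω ≤ R.g c p ω) :
    R.constraintRegret c p ω ≤ 2 * √(β t) * R.sd k σn c (t - 1) p ω := by
  have hsd : 0 ≤ √(β t) * R.sd k σn c (t - 1) p ω :=
    mul_nonneg (Real.sqrt_nonneg _) (Real.sqrt_nonneg _)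
  rw [QueryRun.ucb] at hucb
  exact max_le (by linarith) (by linarith)

theorem mainTheorem5
    {Ω : Type*} [MeasurableSpace Ω] (P : Measure Ω) [IsProbabilityMeasure P]
    -- the finite domains of the upper- and lower-level variables
    {dX dZ : ℕ} (X : Finset (EuclideanSpace ℝ (Fin dX))) (Z : Finset (EuclideanSpace ℝ (Fin dZ)))
    -- the black-box functions: the objectives `F`, `f` and the constraints in `Cup`, `Clo`
    {ι : Type*} [Fintype ι] [DecidableEq ι] (F f : ι) (Cup Clo : Finset ι)
    (hF : {F, f} ∪ Cup ∪ Clo = Finset.univ)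
    -- the Gaussian process priors, the noise level and the run
    (m : ι → X × Z → ℝ) (k : ι → X × Z → X × Z → ℝ) (σn : ℝ≥0) (hσn : 0 < σn)
    (R : QueryRun Ω ι (X × Z)) (hmodel : R.IsModel P m k σn) (hquery : R.NonAnticipating)
    (δ : ℝ) (hδ : δ ∈ Set.Ioo (0 : ℝ) 1) :
    1 - δ ≤ P.real {ω | ∀ t : ℕ, 1 ≤ t →
      ∀ p ∈ R.trustedFeasible m k σn (betaCoeff (Fintype.card ι) X.card Z.card δ) (Cup ∪ Clo) t ω,
      ∀ c ∈ Cup ∪ Clo,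
        R.constraintRegret c p ω ≤
          2 * √(betaCoeff (Fintype.card ι) X.card Z.card δ t) * R.sd k σn c (t - 1) p ω} := by
  classical
  obtain ⟨hδ0, hδ1⟩ := id hδ
  set β := betaCoeff (Fintype.card ι) X.card Z.card δ with hβ
  -- `B t` is failure in round `t + 1`, which uses the data after `t` rounds; hence the coefficient
  -- `β (t + 1)`.
  let B : ℕ → ι → X × Z → Set Ω := fun t c p =>
    {ω | R.g c p ω < R.mu m k σn c t p ω - √(β (t + 1)) * R.sd k σn c t p ω}
  set G := {ω | ∀ t : ℕ, 1 ≤ t → ∀ p ∈ R.trustedFeasible m k σn β (Cup ∪ Clo) t ω,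
      ∀ c ∈ Cup ∪ Clo, R.constraintRegret c p ω ≤ 2 * √(β t) * R.sd k σn c (t - 1) p ω} with hG
  have hcover : Gᶜ ⊆ ⋃ t, ⋃ z ∈ (Finset.univ : Finset (ι × (X × Z))), B t z.1 z.2 := by
    intro ω hω
    by_contra hB
    refine hω fun t ht p hp c hc => QueryRun.constraintRegret_le_of_lcb_le (hp c hc) ?_
    obtain ⟨t, rfl⟩ := Nat.exists_eq_add_of_le' ht
    simp only [Finset.mem_univ, Set.iUnion_true, Set.mem_iUnion, not_exists] at hB
    exact not_lt.1 (hB t (c, p))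
  have hround : ∀ t, P (⋃ z ∈ (Finset.univ : Finset (ι × (X × Z))), B t z.1 z.2) ≤
      ENNReal.ofReal (6 * δ / (((t + 1 : ℕ) : ℝ) ^ 2 * Real.pi ^ 2)) := by
    intro t
    rw [← ofReal_measureReal (measure_ne_top _ _)]
    refine ENNReal.ofReal_le_ofReal ?_
    have hB : ∀ z : ι × (X × Z), P.real (B t z.1 z.2) ≤
        6 * δ / (((t + 1 : ℕ) : ℝ) ^ 2 * Real.pi ^ 2) /
          (Fintype.card ι * X.card * Z.card) := by
      rintro ⟨c, p⟩
      have hι : 0 < Fintype.card ι := Fintype.card_pos_iff.2 ⟨c⟩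
      have hX : 0 < X.card := Finset.card_pos.2 ⟨p.1, p.1.2⟩
      have hZ : 0 < Z.card := Finset.card_pos.2 ⟨p.2, p.2.2⟩
      refine (hmodel.measureReal_lt_lcb_le hσn hquery c t p (Real.sqrt_nonneg _)).trans_eq ?_
      rw [Real.sq_sqrt (betaCoeff_nonneg hι hX hZ hδ t.succ_pos),
        exp_neg_betaCoeff_div_two hι hX hZ hδ0 t.succ_pos]
    calc P.real (⋃ z ∈ (Finset.univ : Finset (ι × (X × Z))), B t z.1 z.2)
        ≤ ∑ z : ι × (X × Z), P.real (B t z.1 z.2) := measureReal_biUnion_finset_le _ _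
      _ ≤ ∑ _z : ι × (X × Z), 6 * δ / (((t + 1 : ℕ) : ℝ) ^ 2 * Real.pi ^ 2) /
            (Fintype.card ι * X.card * Z.card) := Finset.sum_le_sum fun z _ => hB z
      _ = (Fintype.card ι * X.card * Z.card : ℝ) * (6 * δ / (((t + 1 : ℕ) : ℝ) ^ 2 *
            Real.pi ^ 2) / (Fintype.card ι * X.card * Z.card)) := by
          simp [mul_assoc]
      _ ≤ 6 * δ / (((t + 1 : ℕ) : ℝ) ^ 2 * Real.pi ^ 2) := by
          -- The product vanishes when a domain is empty; the union bound then has no terms.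
          rcases eq_or_ne (Fintype.card ι * X.card * Z.card : ℝ) 0 with h0 | h0
          · rw [h0, zero_mul]
            positivity
          · rw [mul_div_cancel₀ _ h0]
  have hsum := hasSum_six_mul_div_sq_mul_pi_sq δ
  have hbad : P Gᶜ ≤ ENNReal.ofReal δ :=
    calc P Gᶜ ≤ ∑' t, P (⋃ z ∈ (Finset.univ : Finset (ι × (X × Z))), B t z.1 z.2) :=
          (measure_mono hcover).trans (measure_iUnion_le _)
      _ ≤ ∑' t : ℕ, ENNReal.ofReal (6 * δ / (((t + 1 : ℕ) : ℝ) ^ 2 * Real.pi ^ 2)) :=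
          ENNReal.tsum_le_tsum hround
      _ = ENNReal.ofReal δ := by
          rw [← ENNReal.ofReal_tsum_of_nonneg (fun t => by positivity) hsum.summable,
            hsum.tsum_eq]
  have hone : 1 ≤ P.real G + P.real Gᶜ := by
    rw [← probReal_univ (μ := P), ← Set.union_compl_self G]
    exact measureReal_union_le _ _
  have : P.real Gᶜ ≤ δ := ENNReal.toReal_le_of_le_ofReal hδ0.le hbad
  linarith
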